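/- Let $N=2^L$, let $M,Y\ge 0$ be integers, and let $f_1,\dots,f_M\in L^2(D)$ be linearly independent in $L^2(D)$ (the representation functions), where $D\subseteq\mathbb R^s$ is Lebesgue measurable (for instance $D=\mathbb R^s$). For a tensor $\mathcal A\in\mathbb R^{M\times\cdots\times M}$ of order $N$, put $$h_{\mathcal A}(x_1,\dots,x_N)=\sum_{d_1,\dots,d_N=1}^M \mathcal A_{d_1\dots d_N}\prod_{i=1}^N f_{d_i}(x_i),\qquad x_i\in D .$$ For $1\le \ell\le L$, the network with $\ell$ hidden layers having $r_0,\dots,r_{\ell-1}$ channels respectively is given by real weight vectors $a^{0,j,\gamma}\in\mathbb R^M$ ($1\le j\le N$, $1\le\gamma\le r_0$), $a^{l,j,\gamma}\in\mathbb R^{r_{l-1}}$ ($1\le l\le \ell-1$, $1\le j\le N/2^l$, $1\le\gamma\le r_l$) and $a^{\ell,y}\in\mathbb R^{r_{\ell-1}}$ ($1\le y\le Y$). With $\phi^{0,j,\gamma}=a^{0,j,\gamma}$, it generates the truncated hierarchical Tucker decomposition $$\phi^{l,j,\gamma}=\sum_{\alpha=1}^{r_{l-1}}a^{l,j,\gamma}_\alpha\,\phi^{l-1,2j-1,\alpha}\otimes\phi^{l-1,2j,\alpha}\quad(1\le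 l\le \ell-1),\qquad \mathcal A^y=\sum_{\alpha=1}^{r_{\ell-1}}a^{\ell,y}_\alpha\bigotimes_{j=1}^{2^{L-\ell+1}}\phi^{\ell-1,j,\alpha},$$ and its score functions are $h_y=h_{\mathcal A^y}$, $1\le y\le Y$. The network is called shared if $a^{l,j,\gamma}=a^{l,\gamma}$ does not depend on the location $j$, for all $0\le l\le\ell-1$. Let $1\le L_2<L_1\le L$. Let network 1 have $L_1$ hidden layers with positive numbers of channels $r^{(1)}_0,\dots,r^{(1)}_{L_1-1}$, and put $r=\min\{M,r^{(1)}_0,\dots,r^{(1)}_{L_2-1}\}$. Draw all weights of network 1 from a continuous distribution, i.e. a probability distribution on the Euclidean space of its weights that is absolutely continuous with respect to Lebesgue measure. Then, with probability one, none of the score functions $h^{(1)}_y$ of network 1 can be approximated arbitrarily well in $L^2$ by networks with $L_2$ hidden layers (without sharing) having fewer than $r^{2^{L-L_2}}$ channels in the last hidden layer: for every $y\in\{1,\dots,Y\}$ there is $\varepsilon>0$ such that $$\int_{D^N}\bigl|h^{(2)}_y-h^{(1)}_y\bigr|^2>\varepsilon$$ for the score function $h^{(2)}_y$ of every network with the same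 representation functions, $L_2$ hidden layers, numbers of channels $r^{(2)}_0,\dots,r^{(2)}_{L_2-1}$ with $r^{(2)}_{L_2-1}<r^{2^{L-L_2}}$, and arbitrary weights. The same conclusion holds if network 1 is shared and its shared weights $\{a^{l,\gamma}\},\{a^{L_1,y}\}$ are drawn from a continuous distribution on the Euclidean space of shared weights, while network 2 remains unshared. -/

import Mathlib

open MeasureTheory

noncomputable section

namespace TruncHT

/-- Real tensors (arrays) of order `n` and dimension `M` in each mode. -/
abbrev Tensor (M n : ℕ) : Type := (Fin n → Fin M) → ℝ

/-- Index set of the individual real weights of a truncated hierarchical Tucker decomposition with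
`Lc` levels of a tensor of order `2 ^ L` and dimension `M` in each mode, with level ranks
`r 0, …, r (Lc - 1)` (the values of `r` beyond these are never used) and `Y` outputs.
* first summand: the entries of the vectors `a^{0,j,γ} ∈ ℝ^M`, over `2 ^ L` locations `j` and
  `r 0` channels `γ`;
* second summand, over the levels `l + 1 ∈ {1, …, Lc - 1}`: the entries of the vectors
  `a^{l+1,j,γ} ∈ ℝ^{r l}`, over `2 ^ (L - (l+1))` locations `j` and `r (l + 1)` channels `γ`;
* third summand: the entries of the output vectors `a^{Lc,y} ∈ ℝ^{r (Lc - 1)}`, over the classes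
  `y`. -/
abbrev WeightIdx (M Y L Lc : ℕ) (r : ℕ → ℕ) : Type :=
  (Fin (2 ^ L) × Fin (r 0) × Fin M) ⊕
    ((Σ l : Fin (Lc - 1), Fin (2 ^ (L - (l.val + 1))) × Fin (r (l.val + 1)) × Fin (r l.val)) ⊕
      (Fin Y × Fin (r (Lc - 1))))

/-- The Euclidean space of all weight configurations; its `volume` is Lebesgue measure. -/
abbrev Weights (M Y L Lc : ℕ) (r : ℕ → ℕ) : Type := WeightIdx M Y L Lc r → ℝ

/-- Index set of the individual weights when they are shared across locations:
the vectors are `a^{0,γ}`, `a^{l+1,γ}` and `a^{Lc,y}`. -/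
abbrev SharedIdx (M Y Lc : ℕ) (r : ℕ → ℕ) : Type :=
  (Fin (r 0) × Fin M) ⊕
    ((Σ l : Fin (Lc - 1), Fin (r (l.val + 1)) × Fin (r l.val)) ⊕
      (Fin Y × Fin (r (Lc - 1))))

/-- The Euclidean space of all shared weight configurations. -/
abbrev SharedWeights (M Y Lc : ℕ) (r : ℕ → ℕ) : Type := SharedIdx M Y Lc r → ℝ

/-- The weight configuration with `a^{l,j,γ} = a^{l,γ}` for every location `j`. -/
def unshare {M Y Lc : ℕ} (L : ℕ) {r : ℕ → ℕ} (w : SharedWeights M Y Lc r) :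
    Weights M Y L Lc r
  | Sum.inl (_, γ, d) => w (Sum.inl (γ, d))
  | Sum.inr (Sum.inl ⟨l, _, γ, α⟩) => w (Sum.inr (Sum.inl ⟨l, γ, α⟩))
  | Sum.inr (Sum.inr (y, α)) => w (Sum.inr (Sum.inr (y, α)))

/-- Mode `i` of the first half of the modes of an order-`2 ^ (l + 1)` tensor. -/
def fstHalf {l : ℕ} (i : Fin (2 ^ l)) : Fin (2 ^ (l + 1)) :=
  ⟨i.val, by have := i.isLt; rw [pow_succ]; omega⟩

/-- Mode `i` of the second half of the modes of an order-`2 ^ (l + 1)` tensor. -/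
def sndHalf {l : ℕ} (i : Fin (2 ^ l)) : Fin (2 ^ (l + 1)) :=
  ⟨2 ^ l + i.val, by have := i.isLt; rw [pow_succ]; omega⟩

/-- The tensor product of two tensors of order `2 ^ l`. -/
def tmul {M l : ℕ} (A B : Tensor M (2 ^ l)) : Tensor M (2 ^ (l + 1)) :=
  fun d => A (fun i => d (fstHalf i)) * B (fun i => d (sndHalf i))

theorem two_mul_two_pow_sub {L l : ℕ} (h : l < L) : 2 ^ (L - l) = 2 * 2 ^ (L - (l + 1)) := by
  rw [← pow_succ']
  congr 1
  omega

/-- The first of the two level-`l` locations merged into location `j` of level `l + 1`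
(location `2j - 1` when counting from one). -/
def fstChild {L l : ℕ} (h : l < L) (j : Fin (2 ^ (L - (l + 1)))) : Fin (2 ^ (L - l)) :=
  ⟨2 * j.val, by have := j.isLt; have := two_mul_two_pow_sub h; omega⟩

/-- The second of the two level-`l` locations merged into location `j` of level `l + 1`
(location `2j` when counting from one). -/
def sndChild {L l : ℕ} (h : l < L) (j : Fin (2 ^ (L - (l + 1)))) : Fin (2 ^ (L - l)) :=
  ⟨2 * j.val + 1, by have := j.isLt; have := two_mul_two_pow_sub h; omega⟩

/-- The intermediate tensor `φ^{l,j,γ}` of order `2 ^ l`, for a level `l ≤ Lc - 1`, where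
`φ^{0,j,γ} = a^{0,j,γ}` and
`φ^{l+1,j,γ} = ∑_α a^{l+1,j,γ}_α φ^{l,2j-1,α} ⊗ φ^{l,2j,α}`. -/
def phi {M Y L Lc : ℕ} {r : ℕ → ℕ} (hL : Lc ≤ L) (w : Weights M Y L Lc r) :
    (l : ℕ) → l ≤ Lc - 1 → Fin (2 ^ (L - l)) → Fin (r l) → Tensor M (2 ^ l)
  | 0, _, j, γ => fun d => w (Sum.inl (j, γ, d 0))
  | l + 1, hl, j, γ => ∑ α : Fin (r l),
      w (Sum.inr (Sum.inl ⟨⟨l, hl⟩, j, γ, α⟩)) •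
        tmul (phi hL w l (by omega) (fstChild (by omega) j) α)
          (phi hL w l (by omega) (sndChild (by omega) j) α)

/-- Mode `i` of the `j`-th block, when the `2 ^ L` modes are cut into consecutive blocks of
length `2 ^ l`. -/
def block {L l : ℕ} (h : l ≤ L) (j : Fin (2 ^ (L - l))) (i : Fin (2 ^ l)) : Fin (2 ^ L) :=
  ⟨j.val * 2 ^ l + i.val, by
    have hi := i.isLt
    have hj : (j.val + 1) * 2 ^ l ≤ 2 ^ (L - l) * 2 ^ l := Nat.mul_le_mul_right _ j.isLt
    rw [← pow_add, Nat.sub_add_cancel h, add_mul, one_mul] at hj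
    omega⟩

/-- The coefficient tensor of output `y`:
`A^y = ∑_α a^{Lc,y}_α ⊗_j φ^{Lc-1,j,α}`, with `j` over all `2 ^ (L - (Lc - 1))` locations
of level `Lc - 1`. -/
def coeffTensor {M Y L Lc : ℕ} {r : ℕ → ℕ} (hL : Lc ≤ L) (w : Weights M Y L Lc r)
    (y : Fin Y) : Tensor M (2 ^ L) :=
  fun d => ∑ α : Fin (r (Lc - 1)), w (Sum.inr (Sum.inr (y, α))) *
    ∏ j : Fin (2 ^ (L - (Lc - 1))),
      phi hL w (Lc - 1) le_rfl j α (fun i => d (block (by omega) j i))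

/-- The function `(x_1, …, x_N) ↦ ∑_{d_1, …, d_N} A_{d_1 … d_N} ∏_i f_{d_i} (x_i)`. -/
def score {E : Type*} {M N : ℕ} (f : Fin M → E → ℝ) (A : Tensor M N) (x : Fin N → E) : ℝ :=
  ∑ d : Fin N → Fin M, A d * ∏ i, f (d i) (x i)

/-- The score function `h_y` computed by the network with `Lc` hidden layers, representation
functions `f` and weights `w`. -/
def netScore {E : Type*} {M Y L Lc : ℕ} {r : ℕ → ℕ} (f : Fin M → E → ℝ) (hL : Lc ≤ L)
    (w : Weights M Y L Lc r) (y : Fin Y) : (Fin (2 ^ L) → E) → ℝ :=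
  score f (coeffTensor hL w y)

/-- The minimal number of channels across the representation layer (`M` channels) and the first
`k` hidden layers (`r 0, …, r (k - 1)` channels). -/
def minChannels (M k : ℕ) (r : ℕ → ℕ) : ℕ :=
  (insert M ((Finset.range k).image r)).min' (Finset.insert_nonempty _ _)

/-- The squared `L²` distance between `g` and `h` over the instances whose `N` components all
range over `D`. -/
def sqDist {s N : ℕ} (D : Set (EuclideanSpace ℝ (Fin s)))
    (g h : (Fin N → EuclideanSpace ℝ (Fin s)) → ℝ) : ℝ :=
  ∫ x, |g x - h x| ^ 2 ∂(Measure.pi fun _ : Fin N => (volume.restrict D))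

end TruncHT

end

/-!
The two kinds of network are separated by the rank of one matricization of the coefficient tensor.
Write `L₂ = k + 1` and cut the `2 ^ L` modes into consecutive blocks of length `2 ^ k`; rows are
indexed by the modes in even blocks, columns by those in odd blocks. A network with `k + 1` hidden
layers produces a sum of `r₂ k` tensors that are products over these blocks, so its matricization
has rank at most `r₂ k` (`det_matricize_coeffTensor_eq_zero` for the principal minor below).

Restrict both index sets to those that are constant, with value below
`c = minChannels M L₂ r₁`, on each of their blocks. This leaves a square matrix of size
`c ^ 2 ^ (L - L₂)`, whose determinant is a polynomial in the weights of network 1. It is not the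
zero polynomial: for the 0/1 weights `diagWeights`, which are shared, the deeper network computes
the tensor power of `∑_{α < c} e_α ⊗ ⋯ ⊗ e_α` (order `2 ^ (k + 1)`), whose submatrix is the identity
(`matricize_coeffTensor_diagWeights`). A real analytic function that is somewhere nonzero vanishes
only on a Lebesgue null set (`ae_ne_zero_of_analyticOnNhd`), so the determinant is almost surely
nonzero, with or without sharing.

The tensors with vanishing determinant form a closed set, so a tensor with nonzero determinant has
positive entrywise distance from it. This distance passes to `L²` because linear independence of the
representation functions makes their Gram matrix `G` invertible: the tensor powers of `G⁻¹` give
functions dual to the products `∏ᵢ f_{dᵢ}(xᵢ)`, and pairing with them recovers each coefficient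
(`exists_sq_le_mul_integral_score_sq`).
-/

noncomputable section

namespace TruncHT

/-! ### Zero sets of real analytic functions -/

/-- A real analytic function on a finite-dimensional space that is nonzero at `x₀` is nonzero almost
everywhere. On every line through `x₀` it has only a null set of zeros, so by Fubini some dilate
about `x₀` of the zero set is null, and Haar null sets are invariant under dilation. -/
theorem ae_ne_zero_of_analyticOnNhd {E : Type*} [NormedAddCommGroup E] [NormedSpace ℝ E]
    [FiniteDimensional ℝ E] [MeasurableSpace E] [BorelSpace E] (μ : Measure E)
    [μ.IsAddHaarMeasure] {F : E → ℝ} (hF : AnalyticOnNhd ℝ F Set.univ) {x₀ : E}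
    (h₀ : F x₀ ≠ 0) : ∀ᵐ x ∂μ, F x ≠ 0 := by
  have hcont : Continuous F := continuousOn_univ.1 hF.continuousOn
  have hline : ∀ᵐ x ∂μ, ∀ᵐ t : ℝ, F (x₀ + t • x) ≠ 0 := by
    refine Filter.Eventually.of_forall fun x => ?_
    have hg : AnalyticOnNhd ℝ (fun t : ℝ => F (x₀ + t • x)) Set.univ := fun t _ =>
      (hF (x₀ + t • x) (Set.mem_univ _)).comp_of_eq (f := fun t : ℝ => x₀ + t • x)
        (by fun_prop) rfl
    have hz := hg.preimage_zero_mem_codiscrete (x := 0) (by simpa using h₀)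
    have := ae_restrict_le_codiscreteWithin (μ := (volume : Measure ℝ)) MeasurableSet.univ hz
    rwa [Measure.restrict_univ] at this
  have hmeas : MeasurableSet {z : E × ℝ | F (x₀ + z.2 • z.1) ≠ 0} :=
    (isOpen_ne_fun (by fun_prop) continuous_const).measurableSet
  have hswap := (Measure.ae_ae_comm (p := fun (x : E) (t : ℝ) => F (x₀ + t • x) ≠ 0) hmeas).1 hline
  have hne : ∀ᵐ t : ℝ, t ≠ 0 := by simp [ae_iff]
  -- a single dilation factor `t ≠ 0` suffices
  obtain ⟨t, ht, ht0⟩ := (hswap.and hne).exists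
  rw [ae_iff] at ht ⊢
  have h1 : {x | ¬ F (x₀ + t • x) ≠ 0} = (t • ·) ⁻¹' {x | ¬ F (x₀ + x) ≠ 0} := rfl
  rw [h1, Measure.addHaar_preimage_smul μ ht0, mul_eq_zero] at ht
  have h2 : μ {x | ¬ F (x₀ + x) ≠ 0} = 0 := by
    refine ht.resolve_left ?_
    simp [ht0]
  have h3 : {x | ¬ F (x₀ + x) ≠ 0} = (x₀ + ·) ⁻¹' {x | ¬ F x ≠ 0} := rfl
  rwa [h3, measure_preimage_add] at h2

/-! ### Recovering coefficients from the `L²` norm -/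

/-- The `L²` pairing of two score functions, in terms of the Gram matrix of the representation
functions. -/
theorem integral_score_mul_score {E : Type*} [MeasurableSpace E] (ν : Measure E) [SigmaFinite ν]
    {M N : ℕ} {f : Fin M → E → ℝ} (hf : ∀ d, MemLp (f d) 2 ν) (A B : Tensor M N) :
    Integrable (fun x => score f A x * score f B x) (Measure.pi fun _ : Fin N => ν) ∧
      ∫ x, score f A x * score f B x ∂(Measure.pi fun _ : Fin N => ν) =
        ∑ d, ∑ e, A d * B e * ∏ i, ∫ x, f (d i) x * f (e i) x ∂ν := by
  have hexp : (fun x => score f A x * score f B x) = fun x : Fin N → E =>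
      ∑ d : Fin N → Fin M, ∑ e : Fin N → Fin M,
        A d * B e * ∏ i, (f (d i) (x i) * f (e i) (x i)) := by
    funext x
    simp only [score, Finset.sum_mul_sum, Finset.prod_mul_distrib]
    exact Finset.sum_congr rfl fun d _ => Finset.sum_congr rfl fun e _ => by ring
  have hint : ∀ d e : Fin N → Fin M, Integrable
      (fun x : Fin N → E => A d * B e * ∏ i, (f (d i) (x i) * f (e i) (x i)))
      (Measure.pi fun _ : Fin N => ν) := fun d e =>
    (Integrable.fintype_prod (f := fun i x => f (d i) x * f (e i) x)
      fun i => (hf (d i)).integrable_mul (hf (e i))).const_mul _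
  rw [hexp]
  refine ⟨integrable_finsetSum _ fun d _ => integrable_finsetSum _ fun e _ => hint d e, ?_⟩
  rw [integral_finsetSum _ fun d _ => integrable_finsetSum _ fun e _ => hint d e]
  refine Finset.sum_congr rfl fun d _ => ?_
  rw [integral_finsetSum _ fun e _ => hint d e]
  refine Finset.sum_congr rfl fun e _ => ?_
  rw [integral_const_mul, integral_fintype_prod_eq_prod (fun i x => f (d i) x * f (e i) x)]

/-- The coefficients of a score function are controlled by its `L²` norm. -/
theorem exists_sq_le_mul_integral_score_sq {E : Type*} [MeasurableSpace E] (ν : Measure E)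
    [SigmaFinite ν] {M : ℕ} (N : ℕ) {f : Fin M → E → ℝ} (hf : ∀ d, MemLp (f d) 2 ν)
    (hind : LinearIndependent ℝ fun d => (hf d).toLp (f d)) :
    ∃ K : ℝ, 0 < K ∧ ∀ (A : Tensor M N) (e : Fin N → Fin M),
      A e ^ 2 ≤ K * ∫ x, |score f A x| ^ 2 ∂(Measure.pi fun _ : Fin N => ν) := by
  set G : Matrix (Fin M) (Fin M) ℝ := Matrix.gram ℝ fun d => (hf d).toLp (f d) with hG
  have hGapp : ∀ d e, G d e = ∫ x, f d x * f e x ∂ν := by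
    intro d e
    rw [hG, Matrix.gram_apply, L2.inner_def]
    refine integral_congr_ae ?_
    filter_upwards [(hf d).coeFn_toLp, (hf e).coeFn_toLp] with x h1 h2
    simp [h1, h2, mul_comm]
  have hdet : IsUnit G.det :=
    isUnit_iff_ne_zero.2 (Matrix.det_gram_ne_zero_iff_linearIndependent.2 hind)
  have hGH : G * G⁻¹ = 1 := Matrix.mul_nonsing_inv G hdet
  -- `score f (C e)` is the function dual to `∏ i, f (e i) (x i)`, see `hdual`
  let C : (Fin N → Fin M) → Tensor M N := fun e d => ∏ i, G⁻¹ (d i) (e i)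
  let I : Tensor M N → Tensor M N → ℝ := fun A B =>
    ∫ x, score f A x * score f B x ∂(Measure.pi fun _ : Fin N => ν)
  have hdual : ∀ A e, I A (C e) = A e := by
    intro A e
    have h1 : ∀ d : Fin N → Fin M, ∑ d' : Fin N → Fin M,
        A d * C e d' * ∏ i, ∫ x, f (d i) x * f (d' i) x ∂ν = if d = e then A d else 0 := by
      intro d
      have h2 : ∏ i, ∑ a, G (d i) a * G⁻¹ a (e i) =
          ∑ d' : Fin N → Fin M, ∏ i, (G (d i) (d' i) * G⁻¹ (d' i) (e i)) := by
        rw [Finset.prod_univ_sum, Fintype.piFinset_univ]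
      simp_rw [← Matrix.mul_apply, hGH, Matrix.one_apply] at h2
      calc _ = A d * ∑ d' : Fin N → Fin M, ∏ i, (G (d i) (d' i) * G⁻¹ (d' i) (e i)) := by
            rw [Finset.mul_sum]
            refine Finset.sum_congr rfl fun d' _ => ?_
            simp only [← hGapp, Finset.prod_mul_distrib, C]
            ring
        _ = _ := by
            rw [← h2]
            by_cases hde : d = e
            · simp [hde]
            · obtain ⟨i, hi⟩ := Function.ne_iff.1 hde
              rw [Finset.prod_eq_zero (Finset.mem_univ i) (by simp [hi]), if_neg hde, mul_zero]
    simp only [I, (integral_score_mul_score ν hf A (C e)).2, h1]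
    simp
  have hI0 : ∀ A, 0 ≤ I A A := fun A => integral_nonneg fun x => mul_self_nonneg _
  have hquad : ∀ A B (t : ℝ), 0 ≤ I A A - 2 * t * I A B + t ^ 2 * I B B := by
    intro A B t
    have hAA := (integral_score_mul_score ν hf A A).1
    have hAB := (integral_score_mul_score ν hf A B).1
    have hBB := (integral_score_mul_score ν hf B B).1
    have hsq : 0 ≤ ∫ x, (score f A x - t * score f B x) ^ 2 ∂(Measure.pi fun _ : Fin N => ν) :=
      integral_nonneg fun x => sq_nonneg _
    have hexp : (fun x => (score f A x - t * score f B x) ^ 2) = fun x =>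
        score f A x * score f A x - 2 * t * (score f A x * score f B x) +
          t ^ 2 * (score f B x * score f B x) := by
      funext x; ring
    have hsub := integral_sub hAA (hAB.const_mul (2 * t))
    have hadd := integral_add (hAA.sub (hAB.const_mul (2 * t))) (hBB.const_mul (t ^ 2))
    simp only [Pi.sub_apply] at hadd
    rwa [hexp, hadd, hsub, integral_const_mul, integral_const_mul] at hsq
  -- the constant exceeds every squared `L²` norm of `score f (C e)`; the summand `1` keeps it positive
  refine ⟨1 + ∑ e, I (C e) (C e), ?_, fun A e => ?_⟩
  · have := Finset.sum_nonneg fun e (_ : e ∈ Finset.univ) => hI0 (C e)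
    linarith
  · have hle : I (C e) (C e) ≤ ∑ e, I (C e) (C e) :=
      Finset.single_le_sum (f := fun e => I (C e) (C e)) (fun e _ => hI0 _) (Finset.mem_univ e)
    have hint : ∫ x, |score f A x| ^ 2 ∂(Measure.pi fun _ : Fin N => ν) = I A A := by
      simp only [I, sq_abs]
      simp only [sq]
    rw [hint]
    set K := 1 + ∑ e, I (C e) (C e)
    have hK : 0 < K := by have := hI0 (C e); simp only [K]; linarith
    -- Cauchy-Schwarz for `A` and `C e`, with a near-optimal value of `t`
    have hq := hquad A (C e) (A e / K)
    rw [hdual] at hq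
    have h3 : (A e / K) ^ 2 * I (C e) (C e) ≤ (A e / K) ^ 2 * K := by
      gcongr
      simp only [K]; linarith
    have h4 : (A e / K) ^ 2 * K = A e ^ 2 / K := by field_simp
    have h5 : 2 * (A e / K) * A e = 2 * (A e ^ 2 / K) := by ring
    rw [h5] at hq
    rw [h4] at h3
    rw [← div_le_iff₀' hK]
    linarith

/-! ### Matricization along alternating blocks -/

/-- The multi-index that on the `b`-th pair of consecutive blocks of length `2 ^ k` takes the value
`p b` on the first (even) block and `q b` on the second (odd) one. -/
def alternate {X : Type*} {L k : ℕ} (hk : k + 1 ≤ L) (p q : Fin (2 ^ (L - (k + 1))) → X) :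
    Fin (2 ^ L) → X := fun i =>
  have hi : i.val / 2 ^ (k + 1) < 2 ^ (L - (k + 1)) := by
    rw [Nat.div_lt_iff_lt_mul (by positivity), ← pow_add, Nat.sub_add_cancel hk]
    exact i.isLt
  if i.val / 2 ^ k % 2 = 0 then p ⟨i.val / 2 ^ (k + 1), hi⟩ else q ⟨i.val / 2 ^ (k + 1), hi⟩

/-- The part of the even-versus-odd-block matricization of `A` in which rows and columns are
multi-indices that are constant, with one of the first `c` values, on each block of length
`2 ^ k`. -/
def matricize {M L k c : ℕ} (hk : k + 1 ≤ L) (hc : c ≤ M) (A : Tensor M (2 ^ L)) :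
    Matrix (Fin (2 ^ (L - (k + 1))) → Fin c) (Fin (2 ^ (L - (k + 1))) → Fin c) ℝ :=
  Matrix.of fun p q => A (alternate hk (Fin.castLE hc ∘ p) (Fin.castLE hc ∘ q))

theorem det_mul_eq_zero_of_card_lt {n m : Type*} [Fintype n] [Fintype m] [DecidableEq n]
    (U : Matrix n m ℝ) (V : Matrix m n ℝ) (h : Fintype.card m < Fintype.card n) :
    (U * V).det = 0 := by
  by_contra hne
  have h1 := Matrix.rank_of_isUnit (U * V)
    ((Matrix.isUnit_iff_isUnit_det _).2 (isUnit_iff_ne_zero.2 hne))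
  have h2 := (Matrix.rank_mul_le_left U V).trans U.rank_le_card_width
  omega

/-- With `k + 1` hidden layers the matricization factors through `ℝ ^ r k`, since every summand of
the coefficient tensor is a product over blocks of length `2 ^ k`. -/
theorem det_matricize_coeffTensor_eq_zero {M Y L k c : ℕ} {r : ℕ → ℕ} (hk : k + 1 ≤ L)
    (hc : c ≤ M) (v : Weights M Y L (k + 1) r) (y : Fin Y)
    (hr : r k < c ^ 2 ^ (L - (k + 1))) :
    (matricize hk hc (coeffTensor hk v y)).det = 0 := by
  have hkL : k ≤ L := by omega
  let T : Fin (r k) → Fin (2 ^ (L - k)) → (Fin (2 ^ L) → Fin M) → ℝ := fun α j d =>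
    phi hk v k le_rfl j α fun i => d (block hkL j i)
  have hdiv : ∀ (j : Fin (2 ^ (L - k))) (i : Fin (2 ^ k)), (block hkL j i).val / 2 ^ k = j.val := by
    intro j i
    have hi := i.isLt
    simp only [block]
    rw [mul_comm, Nat.mul_add_div (by positivity), Nat.div_eq_of_lt hi, add_zero]
  -- The factors `T α j` for even `j` do not see `q`, so `q` may be replaced by `p` there; likewise
  -- `p` by `q` for odd `j`.
  let U : Matrix (Fin (2 ^ (L - (k + 1))) → Fin c) (Fin (r k)) ℝ := Matrix.of fun p α =>
    v (Sum.inr (Sum.inr (y, α))) * ∏ j with (j : Fin (2 ^ (L - k))).val % 2 = 0,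
      T α j (alternate hk (Fin.castLE hc ∘ p) (Fin.castLE hc ∘ p))
  let V : Matrix (Fin (r k)) (Fin (2 ^ (L - (k + 1))) → Fin c) ℝ := Matrix.of fun α q =>
    ∏ j with ¬ (j : Fin (2 ^ (L - k))).val % 2 = 0,
      T α j (alternate hk (Fin.castLE hc ∘ q) (Fin.castLE hc ∘ q))
  have hUV : matricize hk hc (coeffTensor hk v y) = U * V := by
    ext p q
    rw [Matrix.mul_apply]
    simp only [matricize, coeffTensor, Matrix.of_apply, U, V]
    refine Finset.sum_congr rfl fun α _ => ?_
    rw [mul_assoc]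
    congr 1
    refine (Finset.prod_filter_mul_prod_filter_not Finset.univ
      (fun j : Fin (2 ^ (L - k)) => j.val % 2 = 0) fun j =>
        T α j (alternate hk (Fin.castLE hc ∘ p) (Fin.castLE hc ∘ q))).symm.trans ?_
    congr 1
    · refine Finset.prod_congr rfl fun j hj => ?_
      simp only [T]
      congr 1
      funext i
      simp [alternate, hdiv, (Finset.mem_filter.1 hj).2]
    · refine Finset.prod_congr rfl fun j hj => ?_
      simp only [T]
      congr 1
      funext i
      simp [alternate, hdiv, (Finset.mem_filter.1 hj).2]
  rw [hUV]
  exact det_mul_eq_zero_of_card_lt U V (by simpa using hr)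

/-! ### Weights whose matricization is the identity -/

/-- Shared 0/1 weights for which the coefficient tensor is the tensor power of the diagonal tensor
of order `2 ^ (k + 1)` with `c` ones. Channel `γ` carries a tensor power of the basis vector `e_γ`
up to level `k`; every channel of level `k + 1` sums channels `0, …, c - 1` of level `k`; above
that, and in the output, only channel `0` is passed on. -/
def diagWeights {M Y Lc : ℕ} {r : ℕ → ℕ} (k c : ℕ) : SharedWeights M Y Lc r
  | Sum.inl (γ, d) => if d.val = γ.val then 1 else 0
  | Sum.inr (Sum.inl ⟨l, γ, α⟩) =>
      if l.val < k then (if α.val = γ.val then 1 else 0)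
      else if l.val = k then (if α.val < c then 1 else 0)
      else (if α.val = 0 then 1 else 0)
  | Sum.inr (Sum.inr (_, α)) => if α.val = 0 then 1 else 0

theorem forall_halves {l : ℕ} {P : Fin (2 ^ (l + 1)) → Prop} :
    (∀ i, P i) ↔ (∀ i, P (fstHalf i)) ∧ ∀ i, P (sndHalf i) := by
  refine ⟨fun h => ⟨fun i => h _, fun i => h _⟩, fun ⟨h1, h2⟩ i => ?_⟩
  have hi := i.isLt
  have h2l := pow_succ 2 l
  by_cases h : i.val < 2 ^ l
  · exact h1 ⟨i.val, h⟩
  · have := h2 ⟨i.val - 2 ^ l, by omega⟩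
    convert this using 1
    ext
    simp only [sndHalf]
    omega

theorem ite_mul_ite {p q : Prop} [Decidable p] [Decidable q] :
    (if p then (1 : ℝ) else 0) * (if q then 1 else 0) = if p ∧ q then 1 else 0 := by
  by_cases hp : p <;> by_cases hq : q <;> simp [hp, hq]

/-- Up to level `k`, channel `γ < c` carries the tensor power of the basis vector `e_γ`. -/
theorem phi_diagWeights_of_le {M Y L Lc k c : ℕ} {r : ℕ → ℕ} (hL : Lc ≤ L)
    (hr : ∀ l ≤ k, c ≤ r l) (l : ℕ) (hl : l ≤ Lc - 1) (hlk : l ≤ k) (j : Fin (2 ^ (L - l)))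
    (γ : Fin (r l)) (hγ : γ.val < c) (d : Fin (2 ^ l) → Fin M) :
    phi hL (unshare L (diagWeights (Y := Y) k c)) l hl j γ d =
      if ∀ i, (d i).val = γ.val then 1 else 0 := by
  induction l with
  | zero =>
    have : (∀ i : Fin (2 ^ 0), (d i).val = γ.val) ↔ (d 0).val = γ.val :=
      ⟨fun h => h 0, fun h i => by rwa [show i = 0 from Subsingleton.elim (α := Fin 1) i 0]⟩
    simp only [phi, unshare, diagWeights, this]
  | succ l ih =>
    have hlk' : l < k := hlk
    let α₀ : Fin (r l) := ⟨γ.val, hγ.trans_le (hr l hlk'.le)⟩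
    simp only [phi, unshare, diagWeights, Finset.sum_apply, Pi.smul_apply, smul_eq_mul, tmul,
      hlk', if_true]
    rw [Finset.sum_eq_single α₀]
    · rw [ih (by omega) (by omega) _ α₀ hγ, ih (by omega) (by omega) _ α₀ hγ, ite_mul_ite]
      simp only [forall_halves (P := fun i => (d i).val = γ.val)]
      simp [α₀]
    · intro α _ hα
      rw [if_neg (fun h => hα (Fin.ext h)), zero_mul]
    · simp

/-- The multi-index `d` is constant on consecutive blocks of length `2 ^ m`, and all its values are
below `c`. -/
def IsBlockConst {M n : ℕ} (m c : ℕ) (d : Fin n → Fin M) : Prop :=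
  (∀ i, (d i).val < c) ∧ ∀ i i' : Fin n, i.val / 2 ^ m = i'.val / 2 ^ m → d i = d i'

theorem isBlockConst_halves {M l m c : ℕ} (hm : m ≤ l) {d : Fin (2 ^ (l + 1)) → Fin M} :
    IsBlockConst m c d ↔ IsBlockConst m c (fun i => d (fstHalf i)) ∧
      IsBlockConst m c (fun i => d (sndHalf i)) := by
  have hpow : 2 ^ l = 2 ^ m * 2 ^ (l - m) := by rw [← pow_add, Nat.add_sub_cancel' hm]
  have hlt : ∀ i : Fin (2 ^ l), i.val / 2 ^ m < 2 ^ (l - m) := fun i => by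
    rw [Nat.div_lt_iff_lt_mul (by positivity), mul_comm, ← hpow]
    exact i.isLt
  have hsnd : ∀ i : Fin (2 ^ l), (sndHalf i).val / 2 ^ m = 2 ^ (l - m) + i.val / 2 ^ m :=
    fun i => by simp only [sndHalf, hpow, Nat.mul_add_div (Nat.two_pow_pos m)]
  have hfst : ∀ i : Fin (2 ^ l), (fstHalf i).val / 2 ^ m = i.val / 2 ^ m := fun i => rfl
  simp only [IsBlockConst]
  rw [forall_halves (P := fun i => (d i).val < c)]
  simp_rw [forall_halves (l := l), hsnd, hfst]
  constructor
  · rintro ⟨⟨h1, h2⟩, h3⟩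
    exact ⟨⟨h1, fun i => (h3.1 i).1⟩, h2, fun i i' h => (h3.2 i).2 i' (by omega)⟩
  · rintro ⟨⟨h1, h2⟩, h3, h4⟩
    refine ⟨⟨h1, h3⟩, fun i => ⟨fun i' => h2 i i', fun i' h => ?_⟩,
      fun i => ⟨fun i' h => ?_, fun i' h => h4 i i' (by omega)⟩⟩
    · exact absurd (hlt i) (by rw [h]; simp)
    · exact absurd (hlt i') (by rw [← h]; simp)

open Classical in
/-- Above level `k`, every channel carries a tensor power of the diagonal tensor with `c` ones. -/
theorem phi_diagWeights_of_lt {M Y L Lc k c : ℕ} {r : ℕ → ℕ} (hL : Lc ≤ L)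
    (hr : ∀ l ≤ k, c ≤ r l) (hpos : ∀ l < Lc, 0 < r l) (l : ℕ) (hl : l ≤ Lc - 1) (hlk : k < l)
    (j : Fin (2 ^ (L - l))) (γ : Fin (r l)) (d : Fin (2 ^ l) → Fin M) :
    phi hL (unshare L (diagWeights (Y := Y) k c)) l hl j γ d =
      if IsBlockConst (k + 1) c d then 1 else 0 := by
  induction l with
  | zero => omega
  | succ l ih =>
    simp only [phi, unshare, diagWeights, Finset.sum_apply, Pi.smul_apply, smul_eq_mul, tmul,
      if_neg (show ¬ l < k by omega)]
    -- Level `l + 1` either passes on channel `0` (`k < l`) or is the summing level (`l = k`).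
    rcases Nat.lt_or_ge k l with h | h
    · have h0 : 0 < r l := hpos l (by omega)
      simp only [if_neg h.ne']
      rw [Finset.sum_eq_single ⟨0, h0⟩]
      · rw [ih (by omega) h, ih (by omega) h, ite_mul_ite, isBlockConst_halves h]
        simp
      · intro α _ hα
        rw [if_neg (fun h => hα (Fin.ext h)), zero_mul]
      · simp
    · obtain rfl : l = k := by omega
      simp only [if_true]
      have hterm : ∀ α : Fin (r l), (if α.val < c then (1 : ℝ) else 0) *
          (phi hL (unshare L (diagWeights (Y := Y) l c)) l (by omega)
              (fstChild (by omega) j) α (fun i => d (fstHalf i)) *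
            phi hL (unshare L (diagWeights (Y := Y) l c)) l (by omega)
              (sndChild (by omega) j) α (fun i => d (sndHalf i))) =
          if α.val < c ∧ ∀ i, (d i).val = α.val then 1 else 0 := by
        intro α
        by_cases hα : α.val < c
        · rw [phi_diagWeights_of_le hL hr l _ le_rfl _ α hα,
            phi_diagWeights_of_le hL hr l _ le_rfl _ α hα, ite_mul_ite]
          simp only [forall_halves (P := fun i => (d i).val = α.val)]
          simp [hα]
        · simp [hα]
      simp only [hterm]
      let i₀ : Fin (2 ^ (l + 1)) := ⟨0, by positivity⟩
      by_cases hd : IsBlockConst (l + 1) c d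
      · have hconst : ∀ i, d i = d i₀ := fun i => hd.2 i i₀ (by
          rw [Nat.div_eq_of_lt i.isLt, Nat.div_eq_of_lt i₀.isLt])
        have hlt := hd.1 i₀
        rw [if_pos hd, Finset.sum_eq_single ⟨(d i₀).val, hlt.trans_le (hr l le_rfl)⟩]
        · exact if_pos ⟨hlt, fun i => by rw [hconst i]⟩
        · intro α _ hα
          refine if_neg fun h => hα (Fin.ext (h.2 i₀).symm)
        · simp
      · rw [if_neg hd]
        refine Finset.sum_eq_zero fun α _ => if_neg fun h => hd ⟨fun i => ?_, fun i i' _ => ?_⟩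
        · rw [h.2 i]; exact h.1
        · exact Fin.ext ((h.2 i).trans (h.2 i').symm)

theorem isBlockConst_blocks {M L n m c : ℕ} (hm : m ≤ n) (hn : n ≤ L)
    {d : Fin (2 ^ L) → Fin M} :
    IsBlockConst m c d ↔ ∀ j, IsBlockConst m c fun i => d (block hn j i) := by
  have hpow : 2 ^ n = 2 ^ m * 2 ^ (n - m) := by rw [← pow_add, Nat.add_sub_cancel' hm]
  have hdiv : ∀ j i, (block hn j i).val / 2 ^ m = j.val * 2 ^ (n - m) + i.val / 2 ^ m := by
    intro j i
    have hj : j.val * 2 ^ n = 2 ^ m * (j.val * 2 ^ (n - m)) := by rw [hpow, mul_left_comm]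
    simp only [block]
    rw [hj, Nat.mul_add_div (Nat.two_pow_pos m)]
  have hsurj : ∀ i : Fin (2 ^ L), ∃ j : Fin (2 ^ (L - n)), j.val = i.val / 2 ^ n ∧
      ∃ i', i = block hn j i' := by
    intro i
    refine ⟨⟨i.val / 2 ^ n, ?_⟩, rfl, ⟨i.val % 2 ^ n, Nat.mod_lt _ (by positivity)⟩, ?_⟩
    · rw [Nat.div_lt_iff_lt_mul (by positivity), ← pow_add, Nat.sub_add_cancel hn]
      exact i.isLt
    · ext
      simp only [block]
      rw [mul_comm, Nat.div_add_mod]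
  constructor
  · rintro ⟨h1, h2⟩ j
    exact ⟨fun i => h1 _, fun i i' h => h2 _ _ (by rw [hdiv, hdiv, h])⟩
  · intro h
    refine ⟨fun i => ?_, fun i i' hii => ?_⟩
    · obtain ⟨j, -, i', rfl⟩ := hsurj i
      exact (h j).1 i'
    · obtain ⟨j, hj, a, rfl⟩ := hsurj i
      obtain ⟨j', hj', a', rfl⟩ := hsurj i'
      have hjj : j = j' := by
        ext
        rw [hj, hj', hpow, ← Nat.div_div_eq_div_mul, ← Nat.div_div_eq_div_mul, hii]
      subst hjj
      refine (h j).2 a a' ?_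
      rw [hdiv, hdiv] at hii
      omega

open Classical in
theorem coeffTensor_diagWeights {M Y L Lc k c : ℕ} {r : ℕ → ℕ} (hL : Lc ≤ L) (hk : k + 1 < Lc)
    (hr : ∀ l ≤ k, c ≤ r l) (hpos : ∀ l < Lc, 0 < r l) (y : Fin Y) (d : Fin (2 ^ L) → Fin M) :
    coeffTensor hL (unshare L (diagWeights k c : SharedWeights M Y Lc r)) y d =
      if IsBlockConst (k + 1) c d then 1 else 0 := by
  have h0 : 0 < r (Lc - 1) := hpos _ (by omega)
  simp only [coeffTensor]
  rw [Finset.sum_eq_single ⟨0, h0⟩]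
  · simp only [phi_diagWeights_of_lt hL hr hpos (Lc - 1) le_rfl (by omega)]
    rw [isBlockConst_blocks (show k + 1 ≤ Lc - 1 by omega) (show Lc - 1 ≤ L by omega)]
    simp [unshare, diagWeights, Finset.prod_ite_zero]
  · intro α _ hα
    have : α.val ≠ 0 := fun h => hα (Fin.ext h)
    simp [unshare, diagWeights, this]
  · simp

theorem isBlockConst_alternate {M L k c : ℕ} (hk : k + 1 ≤ L) (hc : c ≤ M)
    (p q : Fin (2 ^ (L - (k + 1))) → Fin c) :
    IsBlockConst (k + 1) c (alternate hk (Fin.castLE hc ∘ p) (Fin.castLE hc ∘ q)) ↔ p = q := by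
  constructor
  · rintro ⟨-, h⟩
    funext b
    have hb : (b.val + 1) * 2 ^ (k + 1) ≤ 2 ^ L := by
      calc _ ≤ 2 ^ (L - (k + 1)) * 2 ^ (k + 1) := Nat.mul_le_mul_right _ b.isLt
        _ = 2 ^ L := by rw [← pow_add, Nat.sub_add_cancel hk]
    have h2k : 2 ^ (k + 1) = 2 ^ k * 2 := pow_succ 2 k
    have hkpos := Nat.two_pow_pos k
    rw [h2k] at hb
    let i : Fin (2 ^ L) := ⟨2 ^ k * (2 * b.val), by nlinarith⟩
    let i' : Fin (2 ^ L) := ⟨2 ^ k * (2 * b.val + 1), by nlinarith⟩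
    have hi : i.val / 2 ^ k = 2 * b.val := Nat.mul_div_cancel_left _ hkpos
    have hi' : i'.val / 2 ^ k = 2 * b.val + 1 := Nat.mul_div_cancel_left _ hkpos
    have hb1 : i.val / 2 ^ (k + 1) = b.val := by
      rw [h2k, ← Nat.div_div_eq_div_mul, hi]; omega
    have hb2 : i'.val / 2 ^ (k + 1) = b.val := by
      rw [h2k, ← Nat.div_div_eq_div_mul, hi']; omega
    have := h i i' (hb1.trans hb2.symm)
    have hodd : (2 * b.val + 1) % 2 = 1 := by omega
    simpa [alternate, hi, hi', hb1, hb2, hodd] using this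
  · rintro rfl
    refine ⟨fun i => ?_, fun i i' h => ?_⟩
    · simp [alternate]
    · simp [alternate, h]

theorem matricize_coeffTensor_diagWeights {M Y L Lc k c : ℕ} {r : ℕ → ℕ} (hL : Lc ≤ L)
    (hk : k + 1 < Lc) (hc : c ≤ M) (hr : ∀ l ≤ k, c ≤ r l) (hpos : ∀ l < Lc, 0 < r l)
    (y : Fin Y) :
    matricize (hk.le.trans hL) hc
      (coeffTensor hL (unshare L (diagWeights k c : SharedWeights M Y Lc r)) y) = 1 := by
  ext p q
  simp only [matricize, Matrix.of_apply, coeffTensor_diagWeights hL hk hr hpos,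
    isBlockConst_alternate, Matrix.one_apply]

/-! ### Almost sure separation -/

theorem analyticAt_phi {E : Type*} [NormedAddCommGroup E] [NormedSpace ℝ E] {M Y L Lc : ℕ}
    {r : ℕ → ℕ} (hL : Lc ≤ L) {g : E → Weights M Y L Lc r} {x : E}
    (hg : ∀ idx, AnalyticAt ℝ (fun w => g w idx) x) (l : ℕ) (hl : l ≤ Lc - 1)
    (j : Fin (2 ^ (L - l))) (γ : Fin (r l)) (d : Fin (2 ^ l) → Fin M) :
    AnalyticAt ℝ (fun w => phi hL (g w) l hl j γ d) x := by
  induction l with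
  | zero => exact hg _
  | succ l ih =>
    simp only [phi, Finset.sum_apply, Pi.smul_apply, smul_eq_mul, tmul]
    exact Finset.analyticAt_fun_sum _ fun α _ =>
      (hg _).mul ((ih _ _ _ _).mul (ih _ _ _ _))

theorem analyticAt_coeffTensor {E : Type*} [NormedAddCommGroup E] [NormedSpace ℝ E]
    {M Y L Lc : ℕ} {r : ℕ → ℕ} (hL : Lc ≤ L) {g : E → Weights M Y L Lc r} {x : E}
    (hg : ∀ idx, AnalyticAt ℝ (fun w => g w idx) x) (y : Fin Y) (d : Fin (2 ^ L) → Fin M) :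
    AnalyticAt ℝ (fun w => coeffTensor hL (g w) y d) x :=
  Finset.analyticAt_fun_sum _ fun _ _ =>
    (hg _).mul (Finset.analyticAt_fun_prod _ fun _ _ => analyticAt_phi hL hg _ _ _ _ _)

/-- The weights may depend on a parameter through any analytic map `g` whose range contains
`diagWeights`; this covers both the unshared and the shared case. -/
theorem ae_det_matricize_ne_zero {σ : Type*} [Fintype σ] {M Y L Lc k c : ℕ} {r : ℕ → ℕ}
    (hL : Lc ≤ L) (hk : k + 1 < Lc) (hc : c ≤ M) (hr : ∀ l ≤ k, c ≤ r l)
    (hpos : ∀ l < Lc, 0 < r l) (g : (σ → ℝ) → Weights M Y L Lc r)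
    (hg : ∀ x idx, AnalyticAt ℝ (fun w => g w idx) x)
    (hw : ∃ w₀, g w₀ = unshare L (diagWeights k c)) (y : Fin Y) :
    ∀ᵐ w, (matricize (hk.le.trans hL) hc (coeffTensor hL (g w) y)).det ≠ 0 := by
  obtain ⟨w₀, hw₀⟩ := hw
  refine ae_ne_zero_of_analyticOnNhd volume (x₀ := w₀) (fun x _ => ?_) ?_
  · simp only [Matrix.det_apply', matricize, Matrix.of_apply]
    exact Finset.analyticAt_fun_sum _ fun _ _ => analyticAt_const.mul
      (Finset.analyticAt_fun_prod _ fun _ _ => analyticAt_coeffTensor hL (hg x) _ _)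
  · simp [hw₀, matricize_coeffTensor_diagWeights hL hk hc hr hpos]

theorem score_sub {E : Type*} {M N : ℕ} (f : Fin M → E → ℝ) (A B : Tensor M N)
    (x : Fin N → E) : score f A x - score f B x = score f (A - B) x := by
  simp [score, sub_mul]

/-- A tensor with nonsingular matricization stays away in `L²`, uniformly, from all tensors with
singular matricization. -/
theorem exists_lt_sqDist {s M L k c : ℕ} (hk : k + 1 ≤ L) (hc : c ≤ M)
    (D : Set (EuclideanSpace ℝ (Fin s))) (f : Fin M → EuclideanSpace ℝ (Fin s) → ℝ)
    (hf : ∀ d, MemLp (f d) 2 (volume.restrict D))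
    (hind : LinearIndependent ℝ (fun d => (hf d).toLp (f d)))
    {A : Tensor M (2 ^ L)} (hA : (matricize hk hc A).det ≠ 0) :
    ∃ ε : ℝ, 0 < ε ∧ ∀ B : Tensor M (2 ^ L), (matricize hk hc B).det = 0 →
      ε < sqDist D (score f B) (score f A) := by
  obtain ⟨K, hK, hKle⟩ := exists_sq_le_mul_integral_score_sq (volume.restrict D) (2 ^ L) hf hind
  have hcont : Continuous fun B : Tensor M (2 ^ L) => (matricize hk hc B).det := by
    refine Continuous.matrix_det (continuous_matrix fun p q => ?_)
    simp only [matricize, Matrix.of_apply]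
    exact continuous_apply _
  obtain ⟨δ, hδ, hball⟩ := Metric.isOpen_iff.1 (isOpen_ne_fun hcont continuous_const) A hA
  -- some entry of `B - A` is at least `δ`, so the squared distance is at least `δ ^ 2 / K`;
  -- halving makes the inequality strict
  refine ⟨δ ^ 2 / (2 * K), by positivity, fun B hB => ?_⟩
  have hfar : ¬ ∀ e, dist (B e) (A e) < δ := fun h =>
    hball (Metric.mem_ball.2 ((dist_pi_lt_iff hδ).2 h)) hB
  push Not at hfar
  obtain ⟨e, he⟩ := hfar
  have h1 := hKle (B - A) e
  have h2 : δ ^ 2 ≤ (B - A) e ^ 2 := by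
    rw [Real.dist_eq] at he
    rw [← sq_abs ((B - A) e)]
    exact pow_le_pow_left₀ hδ.le he 2
  have h3 : sqDist D (score f B) (score f A) = ∫ x, |score f (B - A) x| ^ 2
      ∂(Measure.pi fun _ : Fin (2 ^ L) => volume.restrict D) := by
    simp only [sqDist, score_sub]
  rw [h3, div_lt_iff₀ (by positivity)]
  nlinarith [pow_pos hδ 2]

theorem minChannels_le (M k : ℕ) (r : ℕ → ℕ) : minChannels M k r ≤ M :=
  Finset.min'_le _ _ (Finset.mem_insert_self _ _)

theorem minChannels_le_of_lt (M : ℕ) {k l : ℕ} (r : ℕ → ℕ) (h : l < k) :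
    minChannels M k r ≤ r l :=
  Finset.min'_le _ _ (Finset.mem_insert_of_mem
    (Finset.mem_image_of_mem r (Finset.mem_range.2 h)))

/-- The separation for a network of depth `L₁` whose weights are an analytic function `g` of
parameters in a Euclidean space. -/
theorem ae_exists_lt_sqDist_netScore {σ : Type*} [Fintype σ] {s M Y L L₁ k : ℕ}
    (hlt : k + 1 < L₁) (hL₁ : L₁ ≤ L) (D : Set (EuclideanSpace ℝ (Fin s)))
    (f : Fin M → EuclideanSpace ℝ (Fin s) → ℝ)
    (hf : ∀ d, MemLp (f d) 2 (volume.restrict D))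
    (hind : LinearIndependent ℝ (fun d => (hf d).toLp (f d)))
    (r₁ : ℕ → ℕ) (hr₁ : ∀ l < L₁, 0 < r₁ l) (g : (σ → ℝ) → Weights M Y L L₁ r₁)
    (hg : ∀ x idx, AnalyticAt ℝ (fun w => g w idx) x)
    (hw : ∃ w₀, g w₀ = unshare L (diagWeights k (minChannels M (k + 1) r₁))) :
    ∀ᵐ w, ∀ y : Fin Y, ∃ ε : ℝ, 0 < ε ∧ ∀ r₂ : ℕ → ℕ,
      r₂ k < minChannels M (k + 1) r₁ ^ 2 ^ (L - (k + 1)) → ∀ v : Weights M Y L (k + 1) r₂,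
        ε < sqDist D (netScore f (hlt.le.trans hL₁) v y) (netScore f hL₁ (g w) y) := by
  have hc := minChannels_le M (k + 1) r₁
  have hdet := fun y : Fin Y => ae_det_matricize_ne_zero hL₁ hlt hc
    (fun l hl => minChannels_le_of_lt M r₁ (Nat.lt_succ_of_le hl)) hr₁ g hg hw y
  filter_upwards [ae_all_iff.2 hdet] with w hw y
  obtain ⟨ε, hε, h⟩ := exists_lt_sqDist (hlt.le.trans hL₁) hc D f hf hind (hw y)
  exact ⟨ε, hε, fun r₂ hr₂ v => h _ (det_matricize_coeffTensor_eq_zero _ hc v y hr₂)⟩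

theorem analyticAt_unshare {M Y L Lc : ℕ} {r : ℕ → ℕ} (x : SharedWeights M Y Lc r)
    (idx : WeightIdx M Y L Lc r) :
    AnalyticAt ℝ (fun w : SharedWeights M Y Lc r => unshare L w idx) x := by
  rcases idx with ⟨_, γ, d⟩ | ⟨l, _, γ, α⟩ | ⟨y, α⟩ <;>
    exact (ContinuousLinearMap.proj (R := ℝ) (φ := fun _ : SharedIdx M Y Lc r => ℝ) _).analyticAt x

end TruncHT

end

theorem corollary2
    {s M Y L L₁ L₂ : ℕ} (hL₂ : 1 ≤ L₂) (hlt : L₂ < L₁) (hL₁ : L₁ ≤ L)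
    -- the representation functions, linearly independent in `L²(D)`
    (D : Set (EuclideanSpace ℝ (Fin s))) (hD : MeasurableSet D)
    (f : Fin M → EuclideanSpace ℝ (Fin s) → ℝ)
    (hf : ∀ d, MemLp (f d) 2 (volume.restrict D))
    (hind : LinearIndependent ℝ (fun d => (hf d).toLp (f d)))
    -- the numbers of channels of the hidden layers of network 1
    (r₁ : ℕ → ℕ) (hr₁ : ∀ l < L₁, 0 < r₁ l) :
    -- network 1 without sharing
    (∀ μ : Measure (TruncHT.Weights M Y L L₁ r₁), IsProbabilityMeasure μ → μ ≪ volume →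
      ∀ᵐ w ∂μ, ∀ y : Fin Y, ∃ ε : ℝ, 0 < ε ∧
        ∀ r₂ : ℕ → ℕ, r₂ (L₂ - 1) < TruncHT.minChannels M L₂ r₁ ^ 2 ^ (L - L₂) →
          ∀ v : TruncHT.Weights M Y L L₂ r₂,
            ε < TruncHT.sqDist D (TruncHT.netScore f (hlt.le.trans hL₁) v y)
              (TruncHT.netScore f hL₁ w y)) ∧
    -- network 1 with sharing
    (∀ μ : Measure (TruncHT.SharedWeights M Y L₁ r₁), IsProbabilityMeasure μ → μ ≪ volume →
      ∀ᵐ w ∂μ, ∀ y : Fin Y, ∃ ε : ℝ, 0 < ε ∧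
        ∀ r₂ : ℕ → ℕ, r₂ (L₂ - 1) < TruncHT.minChannels M L₂ r₁ ^ 2 ^ (L - L₂) →
          ∀ v : TruncHT.Weights M Y L L₂ r₂,
            ε < TruncHT.sqDist D (TruncHT.netScore f (hlt.le.trans hL₁) v y)
              (TruncHT.netScore f hL₁ (TruncHT.unshare L w) y)) := by
  obtain ⟨k, rfl⟩ : ∃ k, L₂ = k + 1 := ⟨L₂ - 1, by omega⟩
  refine ⟨fun μ _ hμ => hμ.ae_le ?_, fun μ _ hμ => hμ.ae_le ?_⟩
  · exact TruncHT.ae_exists_lt_sqDist_netScore hlt hL₁ D f hf hind r₁ hr₁ (fun w => w)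
      (fun x idx => (ContinuousLinearMap.proj (R := ℝ)
        (φ := fun _ : TruncHT.WeightIdx M Y L L₁ r₁ => ℝ) idx).analyticAt x) ⟨_, rfl⟩
  · exact TruncHT.ae_exists_lt_sqDist_netScore hlt hL₁ D f hf hind r₁ hr₁ (TruncHT.unshare L)
      TruncHT.analyticAt_unshare ⟨_, rfl⟩
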